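/- Let $n_d,n_c\ge 0$ be integers, $q=\max\{n_d,n_c\}$, and let $\mathsf S_u\in\mathbb F_2^{q\times q}$ ($u\le q$) be the down-shift matrix whose last $u$ rows are $[\,\mathsf I_u\ \ 0\,]$ and whose other rows vanish. In the quasi-static bursty linear deterministic interference channel with blocklength $N$, the inputs $X_1,X_2\in\mathbb F_2^{q\times N}$ produce the outputs $$Y_1=\mathsf S_{n_d}X_1\oplus B_1\mathsf S_{n_c}X_2,\qquad Y_2=\mathsf S_{n_d}X_2\oplus B_2\mathsf S_{n_c}X_1,$$ where the interference states $B_1,B_2\in\{0,1\}$ are Bernoulli with activation probability $p\in[0,1]$, constant over the block, independent of the messages, and either independent of each other or fully correlated ($B_1=B_2$). Transmitter $i$ knows $U_i$ and receiver $i$ knows $V_i$, where $U_i=\emptyset$, $V_i=B_i$ (local CSIR), or $U_i=V_i=B_i$ (local CSIRT), or $U_i=V_i=(B_1,B_2)$ (global CSIRT). An opportunistic code with blocklength $N$ and rates $R_i\ge 0$, $\Delta R_i(v)\ge 0$ has independent, uniformly distributed messages $W_i$ (with $2^{NR_i}$ values, rounded up) and $\Delta W_i(v)$ (with $2^{N\Delta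 R_i(v)}$ values, rounded up), one of the latter for every value $v$ of $V_i$; encoders $(W_i,\{\Delta W_i(\cdot)\},U_i)\mapsto X_i$; and decoders $(Y_i,V_i)\mapsto(\hat W_i,\Delta\hat W_i(V_i))$, $i=1,2$. There is no opportunistic message in the worst case: $\Delta R_i(1)=0$ for local CSIR/CSIRT and $\Delta R_i(11)=0$ for global CSIRT. A rate tuple is achievable if there is a sequence of such codes, indexed by $N$, with $\Pr\{\hat W_1\ne W_1\text{ or }\hat W_2\ne W_2\}\to0$ and $\Pr\{(\hat W_i,\Delta\hat W_i(V_i))\ne(W_i,\Delta W_i(V_i))\mid V_i=v\}\to0$ as $N\to\infty$ for $i=1,2$ and every value $v$ that $V_i$ takes with positive probability. The worst-case sum capacity $C$ is the supremum of $R_1+R_2$ over all achievable rate tuples. Theorem. For each of the three CSI levels, and both for independent and for fully correlated interference states, $C$ is the following. If $p=0$, then $C=2n_d$. If $0<p\le 1$, then $C$ is the largest real number $R$ satisfying $$R\le 2n_d,\qquad R\le (n_d-n_c)^++\max\{n_d,n_c\},\qquad R\le 2\max\{(n_d-n_c)^+,n_c\},$$ where $(x)^+=\max\{x,0\}$. (The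 first of these three bounds is implied by the second whenever $n_c\le 2n_d$.) -/

import Mathlib

open Filter Topology

namespace BurstyIC

/-- The levels of channel-state information (CSI). -/
inductive CSI
  | localCSIR
  | localCSIRT
  | globalCSIRT

/-- The two laws of the pair of interference states. -/
inductive Dependence
  | independent
  | fullyCorrelated

/-- A realization of the interference states: `b i` tells whether interference is present at
receiver `i`. The users are `0` and `1` (users 1 and 2 of the literature); the user other than
`i` is `i.rev`. -/
abbrev State := Fin 2 → Bool

/-- The probability that the pair of interference states equals `b`. Each state is Bernoulli with
activation probability `p`. -/
noncomputable def stateProb (κ : Dependence) (p : ℝ) (b : State) : ℝ :=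
  match κ with
  | .independent => ∏ i, if b i then p else 1 - p
  | .fullyCorrelated => if b 0 = b 1 then (if b 0 then p else 1 - p) else 0

/-- The values of the CSI available at a transmitter. -/
def TxInfo : CSI → Type
  | .localCSIR => Unit
  | .localCSIRT => Bool
  | .globalCSIRT => State

/-- The values of the CSI available at a receiver. -/
def RxInfo : CSI → Type
  | .localCSIR => Bool
  | .localCSIRT => Bool
  | .globalCSIRT => State

instance (c : CSI) : Fintype (RxInfo c) :=
  match c with
  | .localCSIR => inferInstanceAs (Fintype Bool)
  | .localCSIRT => inferInstanceAs (Fintype Bool)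
  | .globalCSIRT => inferInstanceAs (Fintype State)

instance (c : CSI) : DecidableEq (RxInfo c) :=
  match c with
  | .localCSIR => inferInstanceAs (DecidableEq Bool)
  | .localCSIRT => inferInstanceAs (DecidableEq Bool)
  | .globalCSIRT => inferInstanceAs (DecidableEq State)

/-- The CSI at transmitter `i` when the interference states are `b`. -/
def txInfo (c : CSI) (i : Fin 2) (b : State) : TxInfo c :=
  match c with
  | .localCSIR => ()
  | .localCSIRT => b i
  | .globalCSIRT => b

/-- The CSI at receiver `i` when the interference states are `b`. -/
def rxInfo (c : CSI) (i : Fin 2) (b : State) : RxInfo c :=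
  match c with
  | .localCSIR => b i
  | .localCSIRT => b i
  | .globalCSIRT => b

/-- The receiver CSI in the worst case, in which interference is present at the receiver (local
CSI) or at both receivers (global CSI). -/
def worstInfo (c : CSI) : RxInfo c := rxInfo c 0 fun _ => true

/-- The `q × q` down-shift matrix over the binary field, for `u ≤ q`: its last `u` rows carry the
identity matrix in the first `u` columns, and all other entries vanish. -/
def shiftMatrix (q u : ℕ) : Matrix (Fin q) (Fin q) (ZMod 2) :=
  Matrix.of fun i j => if (i : ℕ) = (j : ℕ) + (q - u) then 1 else 0

/-- Blocks of `N` channel inputs or outputs, with `q = max n_d n_c` levels each. -/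
abbrev Block (nd nc N : ℕ) := Matrix (Fin (max nd nc)) (Fin N) (ZMod 2)

/-- The output block at receiver `i` when the interference states are `b` and the input blocks
are `X 0` and `X 1`. -/
def channelOutput (nd nc N : ℕ) (b : State) (X : Fin 2 → Block nd nc N) (i : Fin 2) :
    Block nd nc N :=
  shiftMatrix (max nd nc) nd * X i +
    if b i then shiftMatrix (max nd nc) nc * X i.rev else 0

/-- The number of messages of a code of blocklength `N` and rate `R` (in bits per channel use):
`2 ^ (N * R)`, rounded up to an integer. -/
noncomputable def numMessages (N : ℕ) (R : ℝ) : ℕ := ⌈(2 : ℝ) ^ ((N : ℝ) * R)⌉₊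

/-- The regular message of user `i`. -/
abbrev Msg (N : ℕ) (R : Fin 2 → ℝ) (i : Fin 2) := Fin (numMessages N (R i))

/-- The opportunistic messages of user `i`, one for each value of the receiver CSI. -/
abbrev OppMsg (c : CSI) (N : ℕ) (dR : Fin 2 → RxInfo c → ℝ) (i : Fin 2) :=
  ∀ v : RxInfo c, Fin (numMessages N (dR i v))

/-- The regular and opportunistic messages of both users. -/
abbrev AllMsg (c : CSI) (N : ℕ) (R : Fin 2 → ℝ) (dR : Fin 2 → RxInfo c → ℝ) :=
  ∀ i : Fin 2, Msg N R i × OppMsg c N dR i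

/-- Opportunistic codes of blocklength `N` with rates `R i` and opportunistic rates `dR i v`:
two encoders and two decoders. -/
structure Code (nd nc : ℕ) (c : CSI) (N : ℕ) (R : Fin 2 → ℝ) (dR : Fin 2 → RxInfo c → ℝ) where
  enc (i : Fin 2) : Msg N R i → OppMsg c N dR i → TxInfo c → Block nd nc N
  dec (i : Fin 2) : Block nd nc N → ∀ v : RxInfo c, Msg N R i × Fin (numMessages N (dR i v))

section

variable {nd nc : ℕ} {c : CSI} {N : ℕ} {R : Fin 2 → ℝ} {dR : Fin 2 → RxInfo c → ℝ}

/-- What receiver `i` decodes when the messages are `m` and the interference states are `b`. -/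
def Code.decoded (C : Code nd nc c N R dR) (m : AllMsg c N R dR) (b : State) (i : Fin 2) :
    Msg N R i × Fin (numMessages N (dR i (rxInfo c i b))) :=
  C.dec i
    (channelOutput nd nc N b (fun j => C.enc j (m j).1 (m j).2 (txInfo c j b)) i)
    (rxInfo c i b)

/-- Receiver `i` does not recover the regular message of user `i`. -/
def Code.Error (C : Code nd nc c N R dR) (i : Fin 2) (m : AllMsg c N R dR) (b : State) : Prop :=
  (C.decoded m b i).1 ≠ (m i).1

/-- Receiver `i` does not recover the pair of the regular message of user `i` and its
opportunistic message for the present receiver CSI. -/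
def Code.OppError (C : Code nd nc c N R dR) (i : Fin 2) (m : AllMsg c N R dR) (b : State) : Prop :=
  C.decoded m b i ≠ ((m i).1, (m i).2 (rxInfo c i b))

open Classical in
/-- The probability of an event in the messages and the interference states, when all messages
are independent and uniformly distributed, and independent of the interference states. -/
noncomputable def prob (κ : Dependence) (p : ℝ) (E : AllMsg c N R dR → State → Prop) : ℝ :=
  ∑ b : State, stateProb κ p b *
    (((Finset.univ.filter fun m => E m b).card : ℝ) / (Fintype.card (AllMsg c N R dR) : ℝ))

/-- The conditional probability of the event `E` given the event `F`. -/
noncomputable def condProb (κ : Dependence) (p : ℝ) (E F : AllMsg c N R dR → State → Prop) : ℝ :=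
  prob κ p (fun m b => E m b ∧ F m b) / prob κ p F

end

/-- The rate tuple `(R 0, R 1, dR 0 ·, dR 1 ·)` is achievable: some sequence of codes, indexed by
the blocklength `N`, has vanishing probability that a regular message is decoded wrongly, and,
conditioned on any possible value of the CSI of a receiver, vanishing probability that this
receiver decodes its regular message or the corresponding opportunistic message wrongly. There is
no opportunistic message for the worst case. -/
def Achievable (nd nc : ℕ) (c : CSI) (κ : Dependence) (p : ℝ)
    (R : Fin 2 → ℝ) (dR : Fin 2 → RxInfo c → ℝ) : Prop :=
  (∀ i, 0 ≤ R i) ∧ (∀ i v, 0 ≤ dR i v) ∧ (∀ i, dR i (worstInfo c) = 0) ∧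
  ∃ C : ∀ N : ℕ, Code nd nc c N R dR,
    Tendsto (fun N => prob κ p fun m b => (C N).Error 0 m b ∨ (C N).Error 1 m b) atTop (𝓝 0) ∧
    ∀ (i : Fin 2) (v : RxInfo c), (∃ b, 0 < stateProb κ p b ∧ rxInfo c i b = v) →
      Tendsto (fun N => condProb κ p ((C N).OppError i) fun _ b => rxInfo c i b = v) atTop (𝓝 0)

/-- The set of achievable worst-case sum rates. -/
def achievableSumRates (nd nc : ℕ) (c : CSI) (κ : Dependence) (p : ℝ) : Set ℝ :=
  {S | ∃ (R : Fin 2 → ℝ) (dR : Fin 2 → RxInfo c → ℝ),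
    Achievable nd nc c κ p R dR ∧ S = R 0 + R 1}

/-- `C` is the worst-case sum capacity, the supremum of the achievable worst-case sum rates. -/
def IsSumCapacity (nd nc : ℕ) (c : CSI) (κ : Dependence) (p : ℝ) (C : ℝ) : Prop :=
  (achievableSumRates nd nc c κ p).Nonempty ∧ IsLUB (achievableSumRates nd nc c κ p) C

end BurstyIC

/-!
The capacity is that of the interference channel whose interference is always present (if `p > 0`)
or always absent (if `p = 0`): neither the opportunistic messages nor the CSI at the transmitters
help the regular messages in the worst case, and a scheme that copes with interference also works
without it.

*Achievability.* The bounds are attained by linear schemes that act on every channel use separately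
and make no error. Each level carries at most one message bit (`levelInput`, `Decodable`), and all
opportunistic rates are zero. There is one scheme for each range of `nc / nd`, with break points
`1/2`, `2/3`, `1` and `2` (`exists_decodable`). For ratios from `2/3` to `2` the rates of the users
differ, one user repeats its bits periodically, and the other receiver decodes these bits from
levels on which its own signal is absent. A receiver without interference is a receiver whose
interferer sends zeros (`Decodable.of_true`).

*Converse.* Choose a state that has positive probability: interference everywhere if `p > 0`, none
if `p = 0`. The error probability given this state tends to zero, so the opportunistic messages can
be fixed in such a way that a set `G` of at least half of the regular message pairs is decoded
correctly (`Achievable.exists_separates`). Each bound `D` on the sum rate follows from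
`|G| ^ 2 ≤ M₀ * M₁ * 2 ^ (N * D)`, where `Mᵢ` is the number of messages (`Achievable.sum_le`). For
the first two bounds, `G` embeds in a small set. The third replaces the usual entropy argument, in
which receiver `i` is told the interference `Vᵢ` that user `i` causes, by counting: with
`nᵢ` the size of the fibre of `Vᵢ` at the message of user `i`, the sum over `G` of `n₀ / n₁` is at
most `M₀ * 2 ^ (N * max (nd - nc) nc)`, likewise with the users exchanged
(`sum_fiber_ratio_le`), and the Cauchy–Schwarz inequality removes the fibre sizes
(`card_sq_le_of_fibers`).
-/

namespace BurstyIC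

/-! ### The channel, row by row -/

theorem shiftMatrix_mul_apply {q N : ℕ} (u : ℕ) (X : Matrix (Fin q) (Fin N) (ZMod 2))
    (l : Fin q) (j : Fin N) :
    (shiftMatrix q u * X) l j =
      if q - u ≤ (l : ℕ) then X ⟨l - (q - u), lt_of_le_of_lt (Nat.sub_le _ _) l.2⟩ j else 0 := by
  rw [Matrix.mul_apply]
  split_ifs with h
  · rw [Finset.sum_eq_single ⟨l - (q - u), lt_of_le_of_lt (Nat.sub_le _ _) l.2⟩]
    · simp [shiftMatrix, Nat.sub_add_cancel h]
    · intro k _ hk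
      have : (l : ℕ) ≠ k + (q - u) := fun e => hk (Fin.ext (by simp; omega))
      simp [shiftMatrix, this]
    · simp
  · refine Finset.sum_eq_zero fun k _ => ?_
    have : (l : ℕ) ≠ k + (q - u) := by omega
    simp [shiftMatrix, this]

/-- The shift by `q - u` levels retains exactly the top `u` levels of a block. -/
theorem shiftMatrix_mul_eq_iff {q N u : ℕ} (hu : u ≤ q) (X X' : Matrix (Fin q) (Fin N) (ZMod 2)) :
    shiftMatrix q u * X = shiftMatrix q u * X' ↔
      ∀ l : Fin q, (l : ℕ) < u → ∀ j, X l j = X' l j := by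
  constructor
  · intro h l hl j
    have := congrFun (congrFun h ⟨l + (q - u), by omega⟩) j
    rw [shiftMatrix_mul_apply, shiftMatrix_mul_apply] at this
    simpa using this
  · intro h
    ext l j
    rw [shiftMatrix_mul_apply, shiftMatrix_mul_apply]
    split_ifs with hl
    · exact h _ (by simp; omega) j
    · rfl

theorem stateProb_nonneg {p : ℝ} (hp0 : 0 ≤ p) (hp1 : p ≤ 1) (κ : Dependence) (b : State) :
    0 ≤ stateProb κ p b := by
  have h : 0 ≤ 1 - p := sub_nonneg.2 hp1
  cases κ <;> simp only [stateProb]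
  · exact Finset.prod_nonneg fun i _ => by split_ifs <;> assumption
  · split_ifs <;> first | assumption | exact le_rfl

theorem rxInfo_eq_imp {c : CSI} {i : Fin 2} {b b' : State} (h : rxInfo c i b = rxInfo c i b') :
    b i = b' i := by
  cases c
  · exact h
  · exact h
  · exact congrFun h i

theorem numMessages_natCast (N r : ℕ) : numMessages N (r : ℝ) = 2 ^ (r * N) := by
  have : (2 : ℝ) ^ ((N : ℝ) * r) = ((2 ^ (r * N) : ℕ) : ℝ) := by
    rw [← Nat.cast_mul, Real.rpow_natCast, mul_comm]; push_cast; rfl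
  rw [numMessages, this, Nat.ceil_natCast]

theorem numMessages_pos (N : ℕ) (R : ℝ) : 0 < numMessages N R :=
  Nat.ceil_pos.2 (Real.rpow_pos_of_pos two_pos _)

instance (N : ℕ) (R : ℝ) : Nonempty (Fin (numMessages N R)) := ⟨⟨0, numMessages_pos N R⟩⟩

/-! ### Zero-error codes from level assignments -/

/-- The channel input of one user in one channel use, as a function of the level (level `0` is the
most significant one). Level `l` carries the message bit `w k` if `a l = some k`, and it is silent
if `a l = none`. -/
def levelInput (a : ℕ → Option ℕ) (w : ℕ → ZMod 2) (l : ℕ) : ZMod 2 := (a l).elim 0 w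

/-- The output on level `l`, in one channel use, of a receiver whose own transmitter sends `x` and
whose interferer sends `z`, where `β` tells whether interference is present. -/
def levelOutput (nd nc : ℕ) (β : Bool) (x z : ℕ → ZMod 2) (l : ℕ) : ZMod 2 :=
  (if max nd nc - nd ≤ l then x (l - (max nd nc - nd)) else 0) +
    if β then (if max nd nc - nc ≤ l then z (l - (max nd nc - nc)) else 0) else 0

/-- Receiver `i` can recover the `r i` message bits of user `i` when the users place their message
bits by `a` and the interference state of the receiver is `β`. Since the scheme is linear, it is
enough that the zero output forces these bits to vanish. The bits of user `j` are `w j k` for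
`k < r j`; the values `w j k` for other `k` are padding. -/
def Decodable (nd nc : ℕ) (r : Fin 2 → ℕ) (a : Fin 2 → ℕ → Option ℕ) (β : Bool) (i : Fin 2) :
    Prop :=
  ∀ w : Fin 2 → ℕ → ZMod 2, (∀ j k, r j ≤ k → w j k = 0) →
    (∀ l < max nd nc,
      levelOutput nd nc β (levelInput (a i) (w i)) (levelInput (a i.rev) (w i.rev)) l = 0) →
    ∀ k < r i, w i k = 0

/-- A receiver that can cope with interference can also do without: absent interference looks like
an interferer whose message bits all vanish. -/
theorem Decodable.of_true {nd nc : ℕ} {r : Fin 2 → ℕ} {a : Fin 2 → ℕ → Option ℕ} {i : Fin 2}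
    (h : Decodable nd nc r a true i) (β : Bool) : Decodable nd nc r a β i := by
  cases β
  · intro w hw h0 k hk
    have hi : i.rev ≠ i := by fin_cases i <;> decide
    have key := h (Function.update w i.rev 0) (fun j k hjk => ?_) (fun l hl => ?_) k hk
    · simpa [Function.update_of_ne hi.symm] using key
    · rcases eq_or_ne j i.rev with rfl | hj
      · simp
      · simpa [Function.update_of_ne hj] using hw j k hjk
    · rw [← h0 l hl, Function.update_of_ne hi.symm]
      have hz : levelInput (a i.rev) (Function.update w i.rev 0 i.rev) = 0 := by
        funext l
        simp only [levelInput, Function.update_self]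
        cases a i.rev l <;> rfl
      rw [hz]
      simp [levelOutput]
  · exact h

/-- Indexing of the `2 ^ (r * N)` messages of rate `r` by `r` bits per channel use. -/
noncomputable def msgEquiv (N r : ℕ) : Fin (numMessages N (r : ℝ)) ≃ (Fin r → Fin N → ZMod 2) :=
  Fintype.equivOfCardEq (by simp [numMessages_natCast, pow_mul', ZMod.card])

/-- Bit `k` of the message `m` in channel use `j`, padded by zeros for `k ≥ r`. -/
noncomputable def msgBits {N r : ℕ} (m : Fin (numMessages N (r : ℝ))) (j : Fin N) (k : ℕ) :
    ZMod 2 :=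
  if h : k < r then msgEquiv N r m ⟨k, h⟩ j else 0

/-- The block that user `i` sends when it places its message bits by `a` in every channel use. -/
noncomputable def levelBlock (nd nc N : ℕ) {r : Fin 2 → ℕ} (a : Fin 2 → ℕ → Option ℕ) (i : Fin 2)
    (m : Fin (numMessages N (r i : ℝ))) : Block nd nc N :=
  Matrix.of fun l j => levelInput (a i) (msgBits m j) l

theorem channelOutput_levelBlock (nd nc N : ℕ) {r : Fin 2 → ℕ} (a : Fin 2 → ℕ → Option ℕ)
    (b : State) (m : ∀ i, Fin (numMessages N (r i : ℝ))) (i : Fin 2) (l j) :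
    channelOutput nd nc N b (fun i => levelBlock nd nc N a i (m i)) i l j =
      levelOutput nd nc (b i) (levelInput (a i) (msgBits (m i) j))
        (levelInput (a i.rev) (msgBits (m i.rev) j)) l := by
  unfold channelOutput levelOutput
  rw [Matrix.add_apply, shiftMatrix_mul_apply]
  congr 1
  cases b i
  · simp
  · simp only [if_true]
    rw [shiftMatrix_mul_apply]
    rfl

theorem levelInput_sub (a : ℕ → Option ℕ) (w w' : ℕ → ZMod 2) (l : ℕ) :
    levelInput a (w - w') l = levelInput a w l - levelInput a w' l := by
  unfold levelInput
  cases a l <;> simp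

theorem Decodable.msg_eq {nd nc N : ℕ} {r : Fin 2 → ℕ} {a : Fin 2 → ℕ → Option ℕ} {b b' : State}
    {i : Fin 2} (h : Decodable nd nc r a (b i) i) (hb : b i = b' i)
    {m m' : ∀ i, Fin (numMessages N (r i : ℝ))}
    (hm : channelOutput nd nc N b (fun i => levelBlock nd nc N a i (m i)) i =
      channelOutput nd nc N b' (fun i => levelBlock nd nc N a i (m' i)) i) : m i = m' i := by
  apply (msgEquiv N (r i)).injective
  funext k j
  have key := h (fun i => msgBits (m i) j - msgBits (m' i) j) (fun i k hk => ?_) (fun l hl => ?_)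
    k k.2
  · simpa [msgBits, sub_eq_zero] using key
  · simp [msgBits, not_lt.2 hk]
  · have := congrFun (congrFun hm ⟨l, hl⟩) j
    rw [channelOutput_levelBlock, channelOutput_levelBlock, ← hb, ← sub_eq_zero] at this
    rw [← this]
    simp only [levelOutput, levelInput_sub]
    split_ifs <;> ring

/-- The code of blocklength `N` that places message bits by `a` in every channel use and ignores
the CSI at the transmitters. The decoder picks a regular message that is consistent with the
received block and with the CSI. -/
noncomputable def levelCode (nd nc : ℕ) (c : CSI) (κ : Dependence) (p : ℝ) (r : Fin 2 → ℕ)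
    (a : Fin 2 → ℕ → Option ℕ) (N : ℕ) :
    Code nd nc c N (fun i => (r i : ℝ)) (fun _ _ => 0) where
  enc i m _ _ := levelBlock nd nc N a i m
  dec i Y v :=
    (Classical.epsilon fun m₀ => ∃ (m : ∀ i, Fin (numMessages N (r i : ℝ))) (b : State),
      0 < stateProb κ p b ∧ rxInfo c i b = v ∧
      channelOutput nd nc N b (fun i => levelBlock nd nc N a i (m i)) i = Y ∧ m i = m₀,
      ⟨0, numMessages_pos N 0⟩)

theorem levelCode_decoded {nd nc : ℕ} {c : CSI} {κ : Dependence} {p : ℝ} {r : Fin 2 → ℕ}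
    {a : Fin 2 → ℕ → Option ℕ}
    (h : ∀ b, 0 < stateProb κ p b → ∀ i, Decodable nd nc r a (b i) i) (N : ℕ)
    (m : AllMsg c N (fun i => (r i : ℝ)) (fun _ _ => 0)) {b : State} (hb : 0 < stateProb κ p b)
    (i : Fin 2) :
    (levelCode nd nc c κ p r a N).decoded m b i = ((m i).1, (m i).2 (rxInfo c i b)) := by
  refine Prod.ext ?_ ?_
  · have hex : ∃ m₀, ∃ (m' : ∀ i, Fin (numMessages N (r i : ℝ))) (b' : State),
        0 < stateProb κ p b' ∧ rxInfo c i b' = rxInfo c i b ∧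
        channelOutput nd nc N b' (fun i => levelBlock nd nc N a i (m' i)) i =
          channelOutput nd nc N b (fun i => levelBlock nd nc N a i (m i).1) i ∧ m' i = m₀ :=
      ⟨(m i).1, fun i => (m i).1, b, hb, rfl, rfl, rfl⟩
    obtain ⟨m', b', hb', hv, hY, hm⟩ := Classical.epsilon_spec hex
    refine hm.symm.trans ?_
    exact (h b' hb' i).msg_eq (m' := fun i => (m i).1) (rxInfo_eq_imp hv) hY
  · have : Subsingleton (Fin (numMessages N 0)) := by
      have : numMessages N 0 = 1 := by simpa using numMessages_natCast N 0
      rw [this]; infer_instance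
    exact Subsingleton.elim (α := Fin (numMessages N 0)) _ _

theorem prob_eq_zero {c : CSI} {N : ℕ} {R : Fin 2 → ℝ} {dR : Fin 2 → RxInfo c → ℝ}
    {κ : Dependence} {p : ℝ} (hp0 : 0 ≤ p) (hp1 : p ≤ 1) {E : AllMsg c N R dR → State → Prop}
    (h : ∀ b, 0 < stateProb κ p b → ∀ m, ¬ E m b) : prob κ p E = 0 := by
  refine Finset.sum_eq_zero fun b _ => ?_
  rcases (stateProb_nonneg hp0 hp1 κ b).eq_or_lt with h0 | h0
  · rw [← h0, zero_mul]
  · simp [h b h0]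

theorem achievable_of_decodable {nd nc : ℕ} (c : CSI) {κ : Dependence} {p : ℝ} (hp0 : 0 ≤ p)
    (hp1 : p ≤ 1) {r : Fin 2 → ℕ} {a : Fin 2 → ℕ → Option ℕ}
    (h : ∀ b, 0 < stateProb κ p b → ∀ i, Decodable nd nc r a (b i) i) :
    Achievable nd nc c κ p (fun i => (r i : ℝ)) (fun _ _ => 0) := by
  refine ⟨fun i => Nat.cast_nonneg _, fun _ _ => le_rfl, fun _ => rfl,
    levelCode nd nc c κ p r a, ?_, fun i v _ => ?_⟩
  · have : ∀ N, prob κ p (fun m b => (levelCode nd nc c κ p r a N).Error 0 m b ∨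
        (levelCode nd nc c κ p r a N).Error 1 m b) = 0 := fun N =>
      prob_eq_zero hp0 hp1 fun b hb m => by
        simp [Code.Error, levelCode_decoded h N m hb]
    simp [this]
  · have : ∀ N, condProb κ p ((levelCode nd nc c κ p r a N).OppError i)
        (fun _ b => rxInfo c i b = v) = 0 := fun N => by
      rw [condProb, prob_eq_zero hp0 hp1 fun b hb m => by
        simp [Code.OppError, levelCode_decoded h N m hb], zero_div]
    simp [this]

/-! ### Level assignments for all interference strengths -/

section Schemes

variable {nd nc : ℕ}

theorem levelInput_some {a : ℕ → Option ℕ} {l k : ℕ} (h : a l = some k) (w : ℕ → ZMod 2) :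
    levelInput a w l = w k := by simp [levelInput, h]

theorem levelInput_none {a : ℕ → Option ℕ} {l : ℕ} (h : a l = none) (w : ℕ → ZMod 2) :
    levelInput a w l = 0 := by simp [levelInput, h]

theorem levelOutput_of_le (h : nc ≤ nd) (x z : ℕ → ZMod 2) (l : ℕ) :
    levelOutput nd nc true x z l = x l + if nd - nc ≤ l then z (l - (nd - nc)) else 0 := by
  simp [levelOutput, max_eq_left h]

theorem levelOutput_of_ge (h : nd ≤ nc) (x z : ℕ → ZMod 2) (l : ℕ) :
    levelOutput nd nc true x z l = (if nc - nd ≤ l then x (l - (nc - nd)) else 0) + z l := by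
  simp [levelOutput, max_eq_right h]

/-- One message bit on each of the top `n` levels. -/
def topLevels (n l : ℕ) : Option ℕ := if l < n then some l else none

theorem topLevels_some {n l : ℕ} (h : l < n) : topLevels n l = some l := if_pos h

theorem topLevels_none {n l : ℕ} (h : n ≤ l) : topLevels n l = none := if_neg h.not_gt

/-- Without interference, all `nd` levels that reach the receiver carry a bit. -/
theorem decodable_false (i : Fin 2) :
    Decodable nd nc (fun _ => nd) (fun _ => topLevels nd) false i := by
  intro w _ H k hk
  replace hk : k < nd := hk
  have := H (k + (max nd nc - nd)) (by omega)
  simpa [levelOutput, levelInput_some (topLevels_some hk)] using this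

/-- Weak interference: only the levels that are received above the interference are used. -/
theorem decodable_weak (h : 2 * nc ≤ nd) (i : Fin 2) :
    Decodable nd nc (fun _ => nd - nc) (fun _ => topLevels (nd - nc)) true i := by
  intro w _ H k hk
  replace hk : k < nd - nc := hk
  have := H k (by omega)
  rwa [levelOutput_of_le (by omega), if_neg (by omega), add_zero,
    levelInput_some (topLevels_some hk)] at this

/-- Very strong interference: it is received entirely above the useful levels. -/
theorem decodable_veryStrong (h : 2 * nd ≤ nc) (i : Fin 2) :
    Decodable nd nc (fun _ => nd) (fun _ => topLevels nd) true i := by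
  intro w _ H k hk
  replace hk : k < nd := hk
  have := H (k + (nc - nd)) (by omega)
  rwa [levelOutput_of_ge (by omega), if_pos (by omega), Nat.add_sub_cancel,
    levelInput_some (topLevels_some hk), levelInput_none (topLevels_none (by omega)),
    add_zero] at this

/-- The levels below `nc` are invisible to the other receiver and carry bits; so do the top
`2 * nc - nd` levels. The levels between them, where the interference arrives, are silent. -/
def moderateLevels (nd nc l : ℕ) : Option ℕ :=
  if l < 2 * nc - nd then some l
  else if nc ≤ l ∧ l < nd then some (l - (nd - nc)) else none

/-- Moderate interference: the levels in use at a receiver are disjoint from the levels at which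
interference arrives. -/
theorem decodable_moderate (h : nd ≤ 2 * nc) (h' : 3 * nc ≤ 2 * nd) (i : Fin 2) :
    Decodable nd nc (fun _ => nc) (fun _ => moderateLevels nd nc) true i := by
  intro w _ H k hk
  replace hk : k < nc := hk
  rcases lt_or_ge k (2 * nc - nd) with hk' | hk'
  · have := H k (by omega)
    rwa [levelOutput_of_le (by omega), if_neg (by omega), add_zero,
      levelInput_some (k := k) (by simp [moderateLevels, hk'])] at this
  · have := H (k + (nd - nc)) (by omega)
    have h1 : ¬ k + (nd - nc) < 2 * nc - nd := by omega
    have h2 : nc ≤ k + (nd - nc) ∧ k + (nd - nc) < nd := by omega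
    have h3 : ¬ (nc ≤ k ∧ k < nd) := by omega
    rwa [levelOutput_of_le (by omega), if_pos (by omega), Nat.add_sub_cancel,
      levelInput_some (k := k) (by simp only [moderateLevels, if_neg h1, if_pos h2,
        Nat.add_sub_cancel]),
      levelInput_none (l := k) (by simp only [moderateLevels, if_neg hk'.not_gt, if_neg h3]),
      add_zero] at this

/-- With `s = nd - nc`: user `0` uses all levels except the `s` levels just above `nc`. -/
def gappedLevels (nd nc l : ℕ) : Option ℕ :=
  if l < nc - (nd - nc) then some l
  else if nc ≤ l ∧ l < nd then some (l - (nd - nc)) else none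

/-- With `s = nd - nc`: user `1` repeats `s` bits with period `s` on the levels above `nc`, and
puts `s` further bits on the levels below, which the other receiver does not see. -/
def repeatedLevels (nd nc l : ℕ) : Option ℕ :=
  if l < nc then some (l % (nd - nc)) else some (nd - nc + (l - nc))

/-- Every residue modulo `s` occurs among `s` consecutive levels. -/
theorem exists_mod_eq {s ρ : ℕ} (hρ : ρ < s) (n : ℕ) : ∃ l, n ≤ l ∧ l < n + s ∧ l % s = ρ := by
  have hs : 0 < s := by omega
  have hn := Nat.mod_lt n hs
  refine ⟨n + (ρ + s - n % s) % s, by omega, by have := Nat.mod_lt (ρ + s - n % s) hs; omega, ?_⟩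
  have : n + (ρ + s - n % s) = ρ + s * (n / s + 1) := by
    have := Nat.div_add_mod n s
    rw [Nat.mul_add]; omega
  rw [Nat.add_mod, Nat.mod_mod, ← Nat.add_mod, this, Nat.add_mul_mod_self_left,
    Nat.mod_eq_of_lt hρ]

/-- Nearly equal strengths, receiver `0`: the silent levels of user `0` reveal the `s` repeated bits
of user `1`, and with them all interference. -/
theorem decodable_gapped (h : 2 * nd ≤ 3 * nc) (h' : nc ≤ nd) :
    Decodable nd nc ![nc, 2 * (nd - nc)] ![gappedLevels nd nc, repeatedLevels nd nc] true 0 := by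
  intro w hw H k hk
  replace hk : k < nc := hk
  replace H : ∀ l < max nd nc, levelOutput nd nc true (levelInput (gappedLevels nd nc) (w 0))
    (levelInput (repeatedLevels nd nc) (w 1)) l = 0 := H
  have hrep : ∀ l < nc, levelInput (repeatedLevels nd nc) (w 1) l = w 1 (l % (nd - nc)) :=
    fun l hl => levelInput_some (if_pos hl) _
  have hzero : ∀ ρ < nd - nc, w 1 ρ = 0 := by
    intro ρ hρ
    obtain ⟨l, hl1, hl2, hl3⟩ := exists_mod_eq hρ (nc - 2 * (nd - nc))
    have := H (l + (nd - nc)) (by omega)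
    rwa [levelOutput_of_le h', if_pos (by omega), Nat.add_sub_cancel,
      levelInput_none (l := l + (nd - nc)) (by
        rw [gappedLevels, if_neg (by omega), if_neg (by omega)]),
      hrep l (by omega), hl3, zero_add] at this
  have hout : ∀ l < nd, levelInput (gappedLevels nd nc) (w 0) l = 0 := by
    intro l hl
    have := H l (by omega)
    rw [levelOutput_of_le h'] at this
    split_ifs at this with hsl
    · rw [hrep _ (by omega)] at this
      -- for `nd = nc` user `1` has no bits, and `l % 0 = l` refers to the padding
      rcases Nat.eq_zero_or_pos (nd - nc) with hs | hs
      · rw [hw 1 _ (by simp [hs]), add_zero] at this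
        exact this
      · rwa [hzero _ (Nat.mod_lt _ hs), add_zero] at this
    · rwa [add_zero] at this
  rcases lt_or_ge k (nc - (nd - nc)) with hk' | hk'
  · rw [← hout k (by omega), levelInput_some (k := k) (if_pos hk')]
  · rw [← hout (k + (nd - nc)) (by omega), levelInput_some (k := k)]
    rw [gappedLevels, if_neg (by omega), if_pos (by omega), Nat.add_sub_cancel]

/-- Nearly equal strengths, receiver `1`: the top levels are free of interference, and on the levels
below `nc` the silent levels of user `0` arrive. -/
theorem decodable_repeated (h : 2 * nd ≤ 3 * nc) (h' : nc ≤ nd) :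
    Decodable nd nc ![nc, 2 * (nd - nc)] ![gappedLevels nd nc, repeatedLevels nd nc] true 1 := by
  intro w hw H k hk
  replace hk : k < 2 * (nd - nc) := hk
  replace H : ∀ l < max nd nc, levelOutput nd nc true (levelInput (repeatedLevels nd nc) (w 1))
    (levelInput (gappedLevels nd nc) (w 0)) l = 0 := H
  rcases lt_or_ge k (nd - nc) with hk' | hk'
  · have := H k (by omega)
    rwa [levelOutput_of_le h', if_neg (by omega), add_zero, levelInput_some (k := k) (by
      rw [repeatedLevels, if_pos (by omega), Nat.mod_eq_of_lt hk'])] at this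
  · have := H (k - (nd - nc) + nc) (by omega)
    rwa [levelOutput_of_le h', if_pos (by omega), levelInput_some (k := k) (by
        rw [repeatedLevels, if_neg (by omega)]; congr 1; omega),
      levelInput_none (by rw [gappedLevels, if_neg (by omega), if_neg (by omega)]),
      add_zero] at this

/-- The message bits repeated with period `s` over all levels. -/
def periodicLevels (s l : ℕ) : Option ℕ := some (l % s)

theorem levelInput_periodicLevels (s : ℕ) (w : ℕ → ZMod 2) (l : ℕ) :
    levelInput (periodicLevels s) w l = w (l % s) := rfl

/-- Strong interference, receiver `0`: the top `nc - nd` received levels reveal the repeated bits of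
user `1`, and with them all interference. -/
theorem decodable_strong_zero (h : nd ≤ nc) :
    Decodable nd nc ![nd, nc - nd] ![topLevels nd, periodicLevels (nc - nd)] true 0 := by
  intro w hw H k hk
  replace hk : k < nd := hk
  replace H : ∀ l < max nd nc, levelOutput nd nc true (levelInput (topLevels nd) (w 0))
    (levelInput (periodicLevels (nc - nd)) (w 1)) l = 0 := H
  have hzero : ∀ ρ, w 1 ρ = 0 := by
    intro ρ
    rcases lt_or_ge ρ (nc - nd) with hρ | hρ
    · have := H ρ (by omega)
      rwa [levelOutput_of_ge h, if_neg (by omega), zero_add,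
        levelInput_periodicLevels, Nat.mod_eq_of_lt hρ] at this
    · exact hw 1 ρ hρ
  have := H (k + (nc - nd)) (by omega)
  rwa [levelOutput_of_ge h, if_pos (by omega), Nat.add_sub_cancel,
    levelInput_some (topLevels_some hk), levelInput_periodicLevels, hzero, add_zero] at this

/-- Strong interference, receiver `1`: a full period of the repeated bits is received on the levels
below `nd`, where user `0` is silent. -/
theorem decodable_strong_one (h : nd ≤ nc) (h' : nc ≤ 2 * nd) :
    Decodable nd nc ![nd, nc - nd] ![topLevels nd, periodicLevels (nc - nd)] true 1 := by
  intro w hw H k hk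
  replace hk : k < nc - nd := hk
  replace H : ∀ l < max nd nc, levelOutput nd nc true
    (levelInput (periodicLevels (nc - nd)) (w 1)) (levelInput (topLevels nd) (w 0)) l = 0 := H
  obtain ⟨l, hl1, hl2, hl3⟩ := exists_mod_eq hk (nd - (nc - nd))
  have := H (l + (nc - nd)) (by omega)
  rwa [levelOutput_of_ge h, if_pos (by omega), Nat.add_sub_cancel, levelInput_periodicLevels, hl3,
    levelInput_none (topLevels_none (by omega)), add_zero] at this

/-- A sum rate that equals one of the three bounds and does not exceed the others is achieved by
integer rates without error, whatever the relative strength of the interference. -/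
theorem exists_decodable (nd nc D : ℕ) (h1 : D ≤ 2 * nd) (h2 : D ≤ nd - nc + max nd nc)
    (h3 : D ≤ 2 * max (nd - nc) nc)
    (hD : D = 2 * nd ∨ D = nd - nc + max nd nc ∨ D = 2 * max (nd - nc) nc) :
    ∃ (r : Fin 2 → ℕ) (a : Fin 2 → ℕ → Option ℕ), r 0 + r 1 = D ∧
      ∀ i, Decodable nd nc r a true i := by
  rcases le_or_gt (2 * nc) nd with hA | hA
  · exact ⟨_, _, (by omega : nd - nc + (nd - nc) = D), decodable_weak hA⟩
  rcases le_or_gt (3 * nc) (2 * nd) with hB | hB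
  · exact ⟨_, _, (by omega : nc + nc = D), decodable_moderate hA.le hB⟩
  rcases le_or_gt nc nd with hC | hC
  · exact ⟨_, _, (by omega : nc + 2 * (nd - nc) = D),
      Fin.forall_fin_two.2 ⟨decodable_gapped hB.le hC, decodable_repeated hB.le hC⟩⟩
  rcases le_or_gt nc (2 * nd) with hE | hE
  · exact ⟨_, _, (by omega : nd + (nc - nd) = D),
      Fin.forall_fin_two.2 ⟨decodable_strong_zero hC.le, decodable_strong_one hC.le hE⟩⟩
  · exact ⟨_, _, (by omega : nd + nd = D), decodable_veryStrong hE.le⟩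


end Schemes

/-! ### Counting bounds on the correctly decoded messages -/

theorem pair_ext {W : Fin 2 → Type} (i : Fin 2) {u u' : ∀ i, W i} (h : u i = u' i)
    (h' : u i.rev = u' i.rev) : u = u' := by
  funext j
  fin_cases i <;> fin_cases j <;> assumption

/-- If a set of pairs `u` is such that `y u` determines `u i` and `V i.rev (u i.rev)`, and
`y u` takes at most `K` values once `V i (u i)` is given, then the sum over these `u` of the ratio
of the fibre sizes of `V i` and `V i.rev` is at most `K` times the number of values of `u i`.
Indeed, the `u` with given `V i (u i)` and `y u` share `u i` and lie in one fibre of `V i.rev`. -/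
theorem sum_fiber_ratio_le {W : Fin 2 → Type} [∀ i, Fintype (W i)] [∀ i, DecidableEq (W i)]
    {A Y : Type*} [Fintype A] [DecidableEq A] [DecidableEq Y]
    (V : ∀ i, W i → A) (y : (∀ i, W i) → Y) (G : Finset (∀ i, W i)) (i : Fin 2) (K : ℕ)
    (hsep : ∀ u ∈ G, ∀ u' ∈ G, y u = y u' → u i = u' i ∧ V i.rev (u i.rev) = V i.rev (u' i.rev))
    (hK : ∀ a, ((G.filter fun u => V i (u i) = a).image y).card ≤ K) :
    ∑ u ∈ G, ((Finset.univ.filter fun x => V i x = V i (u i)).card : ℝ) /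
        ((Finset.univ.filter fun x => V i.rev x = V i.rev (u i.rev)).card : ℝ) ≤
      Fintype.card (W i) * K := by
  set n : ∀ i, A → ℕ := fun i a => (Finset.univ.filter fun x => V i x = a).card with hn
  calc ∑ u ∈ G, (n i (V i (u i)) : ℝ) / n i.rev (V i.rev (u i.rev))
      = ∑ a, ∑ u ∈ G with V i (u i) = a, (n i (V i (u i)) : ℝ) / n i.rev (V i.rev (u i.rev)) :=
        (Finset.sum_fiberwise _ _ _).symm
    _ ≤ ∑ a, (n i a : ℝ) * K := Finset.sum_le_sum fun a _ => ?_
    _ = Fintype.card (W i) * K := by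
        rw [← Finset.sum_mul, ← Nat.cast_sum, ← Finset.card_univ,
          Finset.card_eq_sum_card_fiberwise (f := V i) (t := Finset.univ) (by simp [Set.MapsTo])]
  set H := G.filter fun u => V i (u i) = a
  have hH : ∀ u ∈ H, u ∈ G ∧ V i (u i) = a := fun u hu => Finset.mem_filter.1 hu
  calc ∑ u ∈ H, (n i (V i (u i)) : ℝ) / n i.rev (V i.rev (u i.rev))
      = ∑ z ∈ H.image y, ∑ u ∈ H with y u = z,
          (n i (V i (u i)) : ℝ) / n i.rev (V i.rev (u i.rev)) :=
        (Finset.sum_fiberwise_of_maps_to (fun u hu => Finset.mem_image_of_mem _ hu) _).symm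
    _ ≤ ∑ z ∈ H.image y, (n i a : ℝ) := Finset.sum_le_sum fun z hz => ?_
    _ = (H.image y).card * n i a := by simp
    _ ≤ n i a * K := by
        rw [mul_comm]
        exact mul_le_mul_of_nonneg_left (Nat.cast_le.2 (hK a)) (Nat.cast_nonneg _)
  obtain ⟨u₀, hu₀, rfl⟩ := Finset.mem_image.1 hz
  have key : ∀ u ∈ H.filter (fun u => y u = y u₀),
      u i = u₀ i ∧ V i.rev (u i.rev) = V i.rev (u₀ i.rev) := by
    intro u hu
    obtain ⟨hu, hy⟩ := Finset.mem_filter.1 hu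
    exact hsep u (hH u hu).1 u₀ (hH u₀ hu₀).1 hy
  have hcard : (H.filter fun u => y u = y u₀).card ≤ n i.rev (V i.rev (u₀ i.rev)) := by
    refine Finset.card_le_card_of_injOn (fun u => u i.rev) (fun u hu => ?_) fun u hu u' hu' h => ?_
    · simpa using (key u hu).2
    · exact pair_ext i ((key u hu).1.trans (key u' hu').1.symm) h
  have hpos : 0 < n i.rev (V i.rev (u₀ i.rev)) :=
    Finset.card_pos.2 ⟨u₀ i.rev, by simp⟩
  calc ∑ u ∈ H with y u = y u₀, (n i (V i (u i)) : ℝ) / n i.rev (V i.rev (u i.rev))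
      = ∑ u ∈ H with y u = y u₀, (n i a : ℝ) / n i.rev (V i.rev (u₀ i.rev)) :=
        Finset.sum_congr rfl fun u hu => by
          rw [(key u hu).2, (hH u (Finset.mem_filter.1 hu).1).2]
    _ = (H.filter fun u => y u = y u₀).card * ((n i a : ℝ) / n i.rev (V i.rev (u₀ i.rev))) := by
        simp
    _ ≤ n i.rev (V i.rev (u₀ i.rev)) * ((n i a : ℝ) / n i.rev (V i.rev (u₀ i.rev))) :=
        mul_le_mul_of_nonneg_right (Nat.cast_le.2 hcard) (by positivity)
    _ = n i a := mul_div_cancel₀ _ (by positivity)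

/-- The product form of `sum_fiber_ratio_le`: the two ratios are inverse to each other, so that
the fibre sizes cancel by the Cauchy–Schwarz inequality. -/
theorem card_sq_le_of_fibers {W : Fin 2 → Type} [∀ i, Fintype (W i)] [∀ i, DecidableEq (W i)]
    {A Y : Type*} [Fintype A] [DecidableEq A] [DecidableEq Y]
    (V : ∀ i, W i → A) (y : Fin 2 → (∀ i, W i) → Y) (G : Finset (∀ i, W i)) (K : ℕ)
    (hsep : ∀ i, ∀ u ∈ G, ∀ u' ∈ G, y i u = y i u' →
      u i = u' i ∧ V i.rev (u i.rev) = V i.rev (u' i.rev))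
    (hK : ∀ i a, ((G.filter fun u => V i (u i) = a).image (y i)).card ≤ K) :
    G.card ^ 2 ≤ Fintype.card (W 0) * Fintype.card (W 1) * K ^ 2 := by
  have h0 := sum_fiber_ratio_le V (y 0) G 0 K (hsep 0) (hK 0)
  have h1 := sum_fiber_ratio_le V (y 1) G 1 K (hsep 1) (hK 1)
  have hCS := Finset.sum_sq_le_sum_mul_sum_of_sq_le_mul G (r := fun _ => (1 : ℝ))
    (f := fun u => ((Finset.univ.filter fun x => V 0 x = V 0 (u 0)).card : ℝ) /
        ((Finset.univ.filter fun x => V 1 x = V 1 (u 1)).card : ℝ))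
    (g := fun u => ((Finset.univ.filter fun x => V 1 x = V 1 (u 1)).card : ℝ) /
        ((Finset.univ.filter fun x => V 0 x = V 0 (u 0)).card : ℝ))
    (fun _ _ => by positivity) (fun _ _ => by positivity) (fun u _ => by
      have hpos : ∀ i, 0 < (Finset.univ.filter fun x => V i x = V i (u i)).card := fun i =>
        Finset.card_pos.2 ⟨u i, by simp⟩
      have p0 := (Nat.cast_pos (α := ℝ)).2 (hpos 0)
      have p1 := (Nat.cast_pos (α := ℝ)).2 (hpos 1)
      rw [div_mul_div_cancel₀ p1.ne', div_self p0.ne', one_pow])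
  have := hCS.trans (mul_le_mul h0 h1 (Finset.sum_nonneg fun _ _ => by positivity)
    (by positivity))
  rw [Finset.sum_const, nsmul_eq_mul, mul_one] at this
  have h2 : ((G.card ^ 2 : ℕ) : ℝ) ≤
      ((Fintype.card (W 0) * Fintype.card (W 1) * K ^ 2 : ℕ) : ℝ) := by
    push_cast
    linarith
  exact_mod_cast h2

/-- On the message pairs in `G`, every receiver can tell its message from its output when the
interference states are `b` and user `i` encodes by `x i`. -/
def Separates {W : Fin 2 → Type} (nd nc N : ℕ) (b : State) (x : ∀ i, W i → Block nd nc N)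
    (G : Finset (∀ i, W i)) : Prop :=
  ∀ i, ∀ u ∈ G, ∀ u' ∈ G,
    channelOutput nd nc N b (fun j => x j (u j)) i =
      channelOutput nd nc N b (fun j => x j (u' j)) i → u i = u' i

section Bounds

variable {nd nc N : ℕ} {b : State} {W : Fin 2 → Type} {x : ∀ i, W i → Block nd nc N}
  {G : Finset (∀ i, W i)}

/-- Given the message of the other user, a message is determined by the top `nd` levels. -/
theorem Separates.card_le_single [∀ i, Fintype (W i)] (h : Separates nd nc N b x G) (i : Fin 2) :
    G.card ≤ Fintype.card (W i.rev) * 2 ^ (N * nd) := by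
  classical
  have : G.card ≤ (Finset.univ : Finset (W i.rev × (Fin nd → Fin N → ZMod 2))).card := by
    refine Finset.card_le_card_of_injOn
      (fun u => (u i.rev, fun l j => x i (u i) ⟨l, by omega⟩ j)) (fun _ _ => by simp) ?_
    intro u hu u' hu' he
    obtain ⟨h1, h2⟩ := Prod.ext_iff.1 he
    refine pair_ext i (h i u hu u' hu' ?_) h1
    have h3 : shiftMatrix (max nd nc) nd * x i (u i) = shiftMatrix (max nd nc) nd * x i (u' i) :=
      (shiftMatrix_mul_eq_iff (le_max_left _ _) _ _).2 fun l hl j =>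
        congrFun (congrFun h2 ⟨l, hl⟩) j
    have h1' : u i.rev = u' i.rev := h1
    simp only [channelOutput, h3, h1']
  simpa [← pow_mul, ZMod.card, mul_comm] using this

theorem Separates.card_sq_le_single [∀ i, Fintype (W i)] (h : Separates nd nc N b x G) :
    G.card ^ 2 ≤ Fintype.card (W 0) * Fintype.card (W 1) * 2 ^ (N * (2 * nd)) := by
  calc G.card ^ 2 = G.card * G.card := sq _
    _ ≤ (Fintype.card (W 1) * 2 ^ (N * nd)) * (Fintype.card (W 0) * 2 ^ (N * nd)) :=
        Nat.mul_le_mul (h.card_le_single 0) (h.card_le_single 1)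
    _ = _ := by rw [two_mul, mul_add, pow_add]; ring

theorem card_le_mul [∀ i, Fintype (W i)] : G.card ≤ Fintype.card (W 0) * Fintype.card (W 1) := by
  classical
  exact G.card_le_univ.trans (by simp [Fintype.card_pi])

/-- In the worst case the output of receiver `0` reveals the message of user `0` and then the
interference, that is, the top `nc` levels of user `1`. Together with the levels of user `1`
between `nc` and `nd` it determines the output of receiver `1`, and hence both messages. -/
theorem Separates.card_sq_le_sum [∀ i, Fintype (W i)] (h : Separates nd nc N (fun _ => true) x G) :
    G.card ^ 2 ≤ Fintype.card (W 0) * Fintype.card (W 1) * 2 ^ (N * (nd - nc + max nd nc)) := by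
  classical
  have : G.card ≤ (Finset.univ : Finset ((Fin (max nd nc) → Fin N → ZMod 2) ×
      (Fin (nd - nc) → Fin N → ZMod 2))).card := by
    refine Finset.card_le_card_of_injOn
      (fun u => (channelOutput nd nc N (fun _ => true) (fun j => x j (u j)) 0,
        fun l j => x 1 (u 1) ⟨l + nc, by omega⟩ j)) (fun _ _ => by simp) ?_
    intro u hu u' hu' he
    obtain ⟨h1, h2⟩ := Prod.ext_iff.1 he
    have e0 : u 0 = u' 0 := h 0 u hu u' hu' h1
    have h3 : shiftMatrix (max nd nc) nc * x 1 (u 1) = shiftMatrix (max nd nc) nc * x 1 (u' 1) := by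
      have h1' : channelOutput nd nc N (fun _ => true) (fun j => x j (u j)) 0 =
        channelOutput nd nc N (fun _ => true) (fun j => x j (u' j)) 0 := h1
      simp only [channelOutput, if_true, e0] at h1'
      exact add_left_cancel h1'
    have h4 : shiftMatrix (max nd nc) nd * x 1 (u 1) = shiftMatrix (max nd nc) nd * x 1 (u' 1) := by
      refine (shiftMatrix_mul_eq_iff (le_max_left _ _) _ _).2 fun l hl j => ?_
      rcases lt_or_ge (l : ℕ) nc with hlc | hlc
      · exact (shiftMatrix_mul_eq_iff (le_max_right _ _) _ _).1 h3 l hlc j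
      · have := congrFun (congrFun h2 ⟨l - nc, by omega⟩) j
        simpa [Nat.sub_add_cancel hlc] using this
    refine pair_ext 0 e0 (h 1 u hu u' hu' ?_)
    have e0' : u (Fin.rev 1) = u' (Fin.rev 1) := e0
    simp only [channelOutput, h4, e0']
  have : G.card ≤ 2 ^ (N * (nd - nc + max nd nc)) := by
    refine this.trans (le_of_eq ?_)
    simp [← pow_mul, ← pow_add, ZMod.card]
    ring
  rw [sq]
  exact Nat.mul_le_mul card_le_mul this

/-- In the worst case, let `V i` be the interference that user `i` causes. Given `V i`, the output
of receiver `i` has only `max (nd - nc) nc` undetermined levels. The output reveals the message of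
user `i` and then the interference `V i.rev`. -/
theorem Separates.card_sq_le_twice [∀ i, Fintype (W i)]
    (h : Separates nd nc N (fun _ => true) x G) :
    G.card ^ 2 ≤
      Fintype.card (W 0) * Fintype.card (W 1) * 2 ^ (N * (2 * max (nd - nc) nc)) := by
  classical
  set m := max (nd - nc) nc with hm
  have hmq : m ≤ max nd nc := by omega
  have := card_sq_le_of_fibers (fun i w => shiftMatrix (max nd nc) nc * x i w)
    (fun i u => channelOutput nd nc N (fun _ => true) (fun j => x j (u j)) i) G (2 ^ (N * m))
    (fun i u hu u' hu' hy => ?_) (fun i a => ?_)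
  · rwa [← pow_mul, mul_assoc N, mul_comm m 2] at this
  · have e := h i u hu u' hu' hy
    refine ⟨e, ?_⟩
    simp only [channelOutput, if_true, e] at hy
    exact add_left_cancel hy
  · have : ((G.filter fun u => shiftMatrix (max nd nc) nc * x i (u i) = a).image
        fun u => channelOutput nd nc N (fun _ => true) (fun j => x j (u j)) i).card ≤
        (Finset.univ : Finset (Fin m → Fin N → ZMod 2)).card := by
      refine Finset.card_le_card_of_injOn
        (fun Y l j => Y ⟨max nd nc - m + l, by omega⟩ j) (fun _ _ => by simp) ?_
      intro Y hY Y' hY' he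
      obtain ⟨u, hu, rfl⟩ := Finset.mem_image.1 (Finset.mem_coe.1 hY)
      obtain ⟨u', hu', rfl⟩ := Finset.mem_image.1 (Finset.mem_coe.1 hY')
      have ha : shiftMatrix (max nd nc) nc * x i (u i) = shiftMatrix (max nd nc) nc * x i (u' i) :=
        (Finset.mem_filter.1 hu).2.trans (Finset.mem_filter.1 hu').2.symm
      ext l j
      rcases lt_or_ge (l : ℕ) (max nd nc - m) with hl | hl
      -- here `nc ≤ nd`, level `l` of user `i` is among the top `nc`, and no interference reaches it
      · simp only [channelOutput, if_true, Matrix.add_apply, shiftMatrix_mul_apply]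
        rw [if_neg (c := max nd nc - nc ≤ (l : ℕ)) (by omega),
          if_neg (c := max nd nc - nc ≤ (l : ℕ)) (by omega), if_pos (by omega), if_pos (by omega),
          (shiftMatrix_mul_eq_iff (le_max_right _ _) _ _).1 ha _ (by simp; omega) j]
      · have := congrFun (congrFun he ⟨l - (max nd nc - m), by omega⟩) j
        simpa [Nat.add_sub_cancel' hl] using this
    simpa [← pow_mul, ZMod.card, mul_comm] using this

end Bounds

/-! ### The converse -/

theorem stateProb_mul_le_prob {c : CSI} {N : ℕ} {R : Fin 2 → ℝ} {dR : Fin 2 → RxInfo c → ℝ}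
    {κ : Dependence} {p : ℝ} (hp0 : 0 ≤ p) (hp1 : p ≤ 1) (E : AllMsg c N R dR → State → Prop)
    [∀ b, DecidablePred fun m => E m b] (b : State) :
    stateProb κ p b * (((Finset.univ.filter fun m => E m b).card : ℝ) /
      (Fintype.card (AllMsg c N R dR) : ℝ)) ≤ prob κ p E := by
  classical
  unfold prob
  refine le_of_eq_of_le ?_ (Finset.single_le_sum
    (fun b _ => mul_nonneg (stateProb_nonneg hp0 hp1 κ b) (by positivity)) (Finset.mem_univ b))
  congr!

/-- If an event has at least half of all message tuples, then for some choice of the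
opportunistic messages it has at least half of the pairs of regular messages. -/
theorem exists_oppMsg {c : CSI} {N : ℕ} {R : Fin 2 → ℝ} {dR : Fin 2 → RxInfo c → ℝ}
    (E : AllMsg c N R dR → Prop) [DecidablePred E]
    (h : Fintype.card (AllMsg c N R dR) ≤ 2 * (Finset.univ.filter E).card) :
    ∃ o : ∀ i, OppMsg c N dR i, Fintype.card (∀ i, Msg N R i) ≤
      2 * (Finset.univ.filter fun w : ∀ i, Msg N R i => E fun i => (w i, o i)).card := by
  let e : ((∀ i, OppMsg c N dR i) × ∀ i, Msg N R i) ≃ AllMsg c N R dR :=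
    { toFun := fun z i => (z.2 i, z.1 i)
      invFun := fun m => (fun i => (m i).2, fun i => (m i).1)
      left_inv := fun _ => rfl
      right_inv := fun _ => rfl }
  have hsum : (Finset.univ.filter E).card = ∑ o : ∀ i, OppMsg c N dR i,
      (Finset.univ.filter fun w : ∀ i, Msg N R i => E fun i => (w i, o i)).card := by
    simp only [Finset.card_filter]
    rw [← Fintype.sum_prod_type', ← e.sum_comp]
    rfl
  have hne : (Finset.univ : Finset (∀ i, OppMsg c N dR i)).Nonempty := by
    have : ∀ i, Nonempty (OppMsg c N dR i) := fun i => by unfold OppMsg; infer_instance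
    exact Finset.univ_nonempty
  obtain ⟨o, -, ho⟩ := Finset.exists_le_of_sum_le
    (f := fun _ : ∀ i, OppMsg c N dR i => Fintype.card (∀ i, Msg N R i))
    (g := fun o => 2 * (Finset.univ.filter fun w : ∀ i, Msg N R i => E fun i => (w i, o i)).card)
    hne (by
      rw [Finset.sum_const, smul_eq_mul, ← Finset.mul_sum, ← hsum, Finset.card_univ,
        ← Fintype.card_prod, Fintype.card_congr e]
      exact h)
  exact ⟨o, ho⟩

/-- An achievable rate tuple gives, for every possible state and all large blocklengths, encoders
for the regular messages alone such that at least half of the message pairs are decoded correctly: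
fix the opportunistic messages suitably. -/
theorem Achievable.exists_separates {nd nc : ℕ} {c : CSI} {κ : Dependence} {p : ℝ}
    {R : Fin 2 → ℝ} {dR : Fin 2 → RxInfo c → ℝ} (hp0 : 0 ≤ p) (hp1 : p ≤ 1)
    (h : Achievable nd nc c κ p R dR) {b : State} (hb : 0 < stateProb κ p b) :
    ∀ᶠ N in atTop, ∃ (x : ∀ i, Msg N R i → Block nd nc N) (G : Finset (∀ i, Msg N R i)),
      Separates nd nc N b x G ∧ Fintype.card (∀ i, Msg N R i) ≤ 2 * G.card := by
  classical
  obtain ⟨-, -, -, C, hC, -⟩ := h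
  filter_upwards [hC.eventually_lt_const (half_pos hb)] with N hN
  set E : AllMsg c N R dR → State → Prop := fun m b => (C N).Error 0 m b ∨ (C N).Error 1 m b with hE
  have hlt := (stateProb_mul_le_prob hp0 hp1 E b).trans_lt hN
  have hM : (0 : ℝ) < Fintype.card (AllMsg c N R dR) := by
    have : ∀ i, Nonempty (Msg N R i × OppMsg c N dR i) := fun i => by
      unfold OppMsg; infer_instance
    exact Nat.cast_pos.2 Fintype.card_pos
  have hbad : 2 * (Finset.univ.filter fun m => E m b).card ≤ Fintype.card (AllMsg c N R dR) := by
    rw [div_eq_mul_one_div (stateProb κ p b), mul_lt_mul_iff_right₀ hb, div_lt_iff₀ hM] at hlt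
    have : (2 * (Finset.univ.filter fun m => E m b).card : ℝ) ≤
      Fintype.card (AllMsg c N R dR) := by linarith
    exact_mod_cast this
  obtain ⟨o, ho⟩ := exists_oppMsg (fun m => ¬ E m b) (by
    have := Finset.card_filter_add_card_filter_not (s := (Finset.univ : Finset (AllMsg c N R dR)))
      (fun m => E m b)
    rw [Finset.card_univ] at this
    omega)
  refine ⟨fun i w => (C N).enc i w (o i) (txInfo c i b), _, ?_, ho⟩
  intro i u hu u' hu' hy
  have hdec : ∀ v : ∀ i, Msg N R i, ¬ E (fun i => (v i, o i)) b →
      ((C N).decoded (fun i => (v i, o i)) b i).1 = v i := by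
    intro v hv
    simp only [hE, Code.Error, not_or, not_not] at hv
    fin_cases i
    · exact hv.1
    · exact hv.2
  rw [← hdec u (Finset.mem_filter.1 hu).2, ← hdec u' (Finset.mem_filter.1 hu').2]
  simp only [Code.decoded, hy]

/-- Counting bounds on the correctly decoded message pairs turn into bounds on the sum rate. -/
theorem Achievable.sum_le {nd nc : ℕ} {c : CSI} {κ : Dependence} {p : ℝ}
    {R : Fin 2 → ℝ} {dR : Fin 2 → RxInfo c → ℝ} (hp0 : 0 ≤ p) (hp1 : p ≤ 1)
    (h : Achievable nd nc c κ p R dR) {b : State} (hb : 0 < stateProb κ p b) (D : ℕ)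
    (hD : ∀ N (x : ∀ i, Msg N R i → Block nd nc N) (G : Finset (∀ i, Msg N R i)),
      Separates nd nc N b x G →
      G.card ^ 2 ≤ Fintype.card (Msg N R 0) * Fintype.card (Msg N R 1) * 2 ^ (N * D)) :
    R 0 + R 1 ≤ D := by
  by_contra! hlt
  have hev : ∀ᶠ N : ℕ in atTop, 2 < (N : ℝ) * (R 0 + R 1 - D) :=
    (tendsto_natCast_atTop_atTop.atTop_mul_const (sub_pos.2 hlt)).eventually_gt_atTop 2
  obtain ⟨N, ⟨x, G, hsep, hG⟩, hN⟩ := ((h.exists_separates hp0 hp1 hb).and hev).exists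
  have hGD := hD N x G hsep
  simp only [Fintype.card_pi, Fin.prod_univ_two, Fintype.card_fin] at hG hGD
  set M₀ := numMessages N (R 0)
  set M₁ := numMessages N (R 1)
  have hpos : 0 < M₀ * M₁ := Nat.mul_pos (numMessages_pos _ _) (numMessages_pos _ _)
  have hM : M₀ * M₁ ≤ 4 * 2 ^ (N * D) := by
    refine Nat.le_of_mul_le_mul_left ?_ hpos
    calc M₀ * M₁ * (M₀ * M₁) ≤ (2 * G.card) * (2 * G.card) := Nat.mul_le_mul hG hG
      _ = 4 * G.card ^ 2 := by ring
      _ ≤ 4 * (M₀ * M₁ * 2 ^ (N * D)) := Nat.mul_le_mul_left _ hGD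
      _ = _ := by ring
  have hM' : (M₀ : ℝ) * M₁ ≤ 4 * 2 ^ (N * D) := by exact_mod_cast hM
  have hlow : (2 : ℝ) ^ ((N : ℝ) * R 0) * 2 ^ ((N : ℝ) * R 1) ≤ M₀ * M₁ :=
    mul_le_mul (Nat.le_ceil _) (Nat.le_ceil _) (by positivity) (by positivity)
  have hle := hlow.trans hM'
  rw [← Real.rpow_add two_pos, ← Real.rpow_natCast 2 (N * D),
    show (4 : ℝ) = 2 ^ (2 : ℝ) by norm_num, ← Real.rpow_add two_pos,
    Real.rpow_le_rpow_left_iff one_lt_two] at hle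
  push_cast at hle
  linarith

theorem isSumCapacity_of_isGreatest {nd nc : ℕ} {c : CSI} {κ : Dependence} {p C : ℝ}
    (h : IsGreatest (achievableSumRates nd nc c κ p) C) : IsSumCapacity nd nc c κ p C :=
  ⟨h.nonempty, h.isLUB⟩

theorem stateProb_false_zero (κ : Dependence) : 0 < stateProb κ 0 fun _ => false := by
  cases κ <;> simp [stateProb]

theorem stateProb_true_pos (κ : Dependence) {p : ℝ} (hp : 0 < p) :
    0 < stateProb κ p fun _ => true := by
  cases κ <;> simp [stateProb, hp]

theorem eq_false_of_stateProb_zero_pos {κ : Dependence} {b : State} (h : 0 < stateProb κ 0 b)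
    (i : Fin 2) : b i = false := by
  by_contra hi
  rw [Bool.not_eq_false] at hi
  refine h.ne' ?_
  cases κ
  · exact Finset.prod_eq_zero (Finset.mem_univ i) (by simp [hi])
  · simp only [stateProb]
    split_ifs with h1 h2
    · rfl
    · fin_cases i <;> simp_all
    · rfl

theorem isGreatest_achievableSumRates_zero (nd nc : ℕ) (c : CSI) (κ : Dependence) :
    IsGreatest (achievableSumRates nd nc c κ 0) (2 * nd) := by
  refine ⟨⟨_, _, achievable_of_decodable (r := fun _ => nd) (a := fun _ => topLevels nd) c le_rfl
    zero_le_one fun b hb i => ?_, two_mul _⟩, ?_⟩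
  · rw [eq_false_of_stateProb_zero_pos hb i]
    exact decodable_false i
  · rintro S ⟨R, dR, hR, rfl⟩
    exact_mod_cast hR.sum_le le_rfl zero_le_one (stateProb_false_zero κ) (2 * nd)
      fun N x G hG => hG.card_sq_le_single

theorem isGreatest_achievableSumRates (nd nc : ℕ) (c : CSI) (κ : Dependence) {p : ℝ} (hp0 : 0 < p)
    (hp1 : p ≤ 1) :
    IsGreatest (achievableSumRates nd nc c κ p)
      (min (2 * nd) (min (nd - nc + max nd nc) (2 * max (nd - nc) nc)) : ℕ) := by
  refine ⟨?_, ?_⟩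
  · obtain ⟨r, a, hr, ha⟩ := exists_decodable nd nc
      (min (2 * nd) (min (nd - nc + max nd nc) (2 * max (nd - nc) nc))) (by omega) (by omega)
      (by omega) (by omega)
    exact ⟨_, _, achievable_of_decodable c hp0.le hp1 fun b _ i => (ha i).of_true (b i), by
      rw [← hr, Nat.cast_add]⟩
  · rintro S ⟨R, dR, hR, rfl⟩
    have hb := stateProb_true_pos κ hp0
    simp only [Nat.cast_min, le_min_iff]
    exact ⟨hR.sum_le hp0.le hp1 hb _ fun N x G hG => hG.card_sq_le_single,
      hR.sum_le hp0.le hp1 hb _ fun N x G hG => hG.card_sq_le_sum,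
      hR.sum_le hp0.le hp1 hb _ fun N x G hG => hG.card_sq_le_twice⟩

end BurstyIC

theorem theorem2 (nd nc : ℕ) (p : ℝ) (hp0 : 0 ≤ p) (hp1 : p ≤ 1)
    (c : BurstyIC.CSI) (κ : BurstyIC.Dependence) :
    ∃ C : ℝ, BurstyIC.IsSumCapacity nd nc c κ p C ∧
      (p = 0 → IsGreatest {R : ℝ | R ≤ 2 * (nd : ℝ)} C) ∧
      (0 < p → IsGreatest {R : ℝ |
        R ≤ 2 * (nd : ℝ) ∧
        R ≤ max ((nd : ℝ) - nc) 0 + max (nd : ℝ) nc ∧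
        R ≤ 2 * max (max ((nd : ℝ) - nc) 0) nc} C) := by
  rcases hp0.eq_or_lt with rfl | hp
  · exact ⟨_, BurstyIC.isSumCapacity_of_isGreatest
      (BurstyIC.isGreatest_achievableSumRates_zero nd nc c κ), fun _ => isGreatest_Iic,
      fun h => absurd h (lt_irrefl _)⟩
  · refine ⟨_, BurstyIC.isSumCapacity_of_isGreatest
      (BurstyIC.isGreatest_achievableSumRates nd nc c κ hp hp1),
      fun h => absurd h hp.ne', fun _ => ?_⟩
    -- natural-number subtraction is the positive part of the difference
    have hsub : ((nd - nc : ℕ) : ℝ) = max ((nd : ℝ) - nc) 0 := by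
      rcases le_total nc nd with h | h
      · rw [Nat.cast_sub h, max_eq_left (sub_nonneg.2 (Nat.cast_le.2 h))]
      · rw [Nat.sub_eq_zero_of_le h, Nat.cast_zero,
          max_eq_right (sub_nonpos.2 (Nat.cast_le.2 h))]
    push_cast [hsub]
    simp only [← le_min_iff]
    exact isGreatest_Iic
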